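/- **Notation.** Let $H^s(\mathbb R^2)$, $s\in\{0,-2\}$, be the ($L^2$-based, complex-valued) Sobolev spaces on $\mathbb R^2$, so $H^0=L^2$. Let $\widehat H^s(\mathbb R^2)$ be the subspace of all $f\in H^s(\mathbb R^2)$ that are even with respect to $x_1$, i.e. $\langle f,\varphi(-x_1,x_2)\rangle=\langle f,\varphi(x_1,x_2)\rangle$ for all Schwartz functions $\varphi$. For $T>0$, a control $u\in L^\infty(0,T)$ (possibly complex-valued) and $W^0\in\widehat H^0(\mathbb R^2)$ consider the system $$W_t=\Delta W-2\delta\,u(t),\quad t\in(0,T),\qquad W(\cdot,0)=W^0, \tag{1}$$ where $\Delta=\partial_{x_1}^2+\partial_{x_2}^2$ and $\delta$ is the Dirac distribution at the origin of $\mathbb R^2$. A solution of (1) is a map $W:[0,T]\to\widehat H^0(\mathbb R^2)$ with $W(\cdot,0)=W^0$ that is absolutely continuous as a map into $H^{-2}(\mathbb R^2)$ and whose derivative $W_t$ in $H^{-2}(\mathbb R^2)$ exists, lies in $\widehat H^{-2}(\mathbb R^2)$ and equals $\Delta W-2\delta u(t)$ for almost all $t\in(0,T)$. The state $W^0$ is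 called controllable to the state $W^T\in\widehat H^0(\mathbb R^2)$ in time $T$ if there is a control $u\in L^\infty(0,T)$ for which (1) has a unique solution $W$ and this solution satisfies $W(\cdot,T)=W^T$. **Theorem.** Let $T>0$ and $W^0\in\widehat H^0(\mathbb R^2)$. If $W^0$ is controllable to the state $W^T=0$ in time $T$, then $W^0=0$. Equivalently, no nonzero initial state $W^0\in\widehat H^0(\mathbb R^2)$ is controllable to $0$ in any time $T>0$. -/

import Mathlib

open MeasureTheory Set TemperedDistribution
open scoped SchwartzMap Laplacian

noncomputable section

/-- The plane `ℝ²` with the Euclidean norm; the coordinates `x₁`, `x₂` of `x` are `x 0`, `x 1`. -/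
abbrev Plane : Type := EuclideanSpace ℝ (Fin 2)

/-- The reflection `(x₁, x₂) ↦ (-x₁, x₂)`. -/
def reflectFst : Plane ≃L[ℝ] Plane :=
  (LinearIsometryEquiv.piLpCongrRight 2
    (![LinearIsometryEquiv.neg ℝ, LinearIsometryEquiv.refl ℝ ℝ] :
      Fin 2 → (ℝ ≃ₗᵢ[ℝ] ℝ))).toContinuousLinearEquiv

theorem reflectFst_apply (x : Plane) : reflectFst x = !₂[-x 0, x 1] := by
  ext i
  fin_cases i <;> simp [reflectFst]

/-- A tempered distribution on `ℝ²` is even with respect to `x₁` if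
`⟨f, φ(-x₁, x₂)⟩ = ⟨f, φ(x₁, x₂)⟩` for every Schwartz function `φ`. -/
def IsEvenFst (f : 𝓢'(Plane, ℂ)) : Prop :=
  ∀ φ : 𝓢(Plane, ℂ),
    f (SchwartzMap.compCLMOfContinuousLinearEquiv ℂ reflectFst φ) = f φ

/-- The space `Ĥ^s(ℝ²)`: elements of the Sobolev space `H^s(ℝ²)` (based on `L²`, complex valued)
which are even with respect to `x₁`. In particular `Ĥ^0(ℝ²)` consists of the (distributions given
by) functions in `L²(ℝ²)` that are even in `x₁`. -/
def evenSobolev (s : ℝ) : Set 𝓢'(Plane, ℂ) :=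
  {f | MemSobolev s 2 f ∧ IsEvenFst f}

/-- `V` is the time derivative on `(0, T)` of the curve `W` in the Sobolev space `H^s(ℝ²)`:
the curve `W : [0, T] → H^s(ℝ²)` is absolutely continuous, and for almost all `t ∈ (0, T)` it is
differentiable at `t` with derivative `V t`, both with respect to the norm of `H^s(ℝ²)`.
The Bessel potential of order `s` identifies `H^s(ℝ²)` (with an equivalent norm) with `L²(ℝ²)`;
`Y` and `Z` are the curves in `L²(ℝ²)` that correspond to `W` and `V`. -/
def HasSobolevTimeDeriv (s T : ℝ) (W V : ℝ → 𝓢'(Plane, ℂ)) : Prop :=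
  ∃ Y Z : ℝ → Lp ℂ 2 (volume : Measure Plane),
    (∀ t ∈ Icc 0 T, besselPotential Plane ℂ s (W t) = Y t) ∧
    AbsolutelyContinuousOnInterval Y 0 T ∧
    ∀ᵐ t ∂(volume.restrict (Ioo 0 T)),
      besselPotential Plane ℂ s (V t) = Z t ∧ HasDerivAt Y (Z t) t

/-- `W` solves on `[0, T]` the control system `W_t = Δ W - 2 δ u(t)`, `W(·, 0) = W0`, where
`W : [0, T] → Ĥ^0(ℝ²)` and its time derivative `V` takes values in `Ĥ^{-2}(ℝ²)`. As the control
`u` is only an essentially bounded function of time, the equation is for almost all `t`. -/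
structure IsSolution (T : ℝ) (u : ℝ → ℂ) (W0 : 𝓢'(Plane, ℂ)) (W : ℝ → 𝓢'(Plane, ℂ)) :
    Prop where
  mem : ∀ t ∈ Icc 0 T, W t ∈ evenSobolev 0
  initial : W 0 = W0
  equation : ∃ V : ℝ → 𝓢'(Plane, ℂ), HasSobolevTimeDeriv (-2) T W V ∧
    ∀ᵐ t ∂(volume.restrict (Ioo 0 T)),
      V t ∈ evenSobolev (-2) ∧ V t = Δ (W t) - (2 * u t) • delta (0 : Plane)

/-- The set `R_T(W0)` of all states `WT ∈ Ĥ^0(ℝ²)` for which there is a control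
`u ∈ L^∞(0, T)` such that the control system has a unique solution `W` on `[0, T]` and
`W(·, T) = WT`. -/
def reachableSet (T : ℝ) (W0 : 𝓢'(Plane, ℂ)) : Set 𝓢'(Plane, ℂ) :=
  {WT | WT ∈ evenSobolev 0 ∧
    ∃ u : ℝ → ℂ, MemLp u ⊤ (volume.restrict (Ioo 0 T)) ∧
      ∃ W : ℝ → 𝓢'(Plane, ℂ), IsSolution T u W0 W ∧
        (∀ W' : ℝ → 𝓢'(Plane, ℂ), IsSolution T u W0 W' → EqOn W' W (Icc 0 T)) ∧
        W T = WT}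

/-- The state `W0` is controllable to the target state `WT` in the given time `T`. -/
def IsControllable (T : ℝ) (W0 WT : 𝓢'(Plane, ℂ)) : Prop :=
  WT ∈ reachableSet T W0

end

/-! ### Exponential transforms of functions on a bounded interval. -/

section ExpTransform

open Filter Topology

/-! Put v = 2u and F(z) = ∫₀ᵀ e^{zt} v(t) dt (`expTransform`). On the Fourier side the equation is a
scalar linear ODE at each frequency ξ, with forcing -v(t), since δ has constant transform 1. Ending
at 0 therefore forces Ŵ⁰(ξ) = F(4π²|ξ|²). This is `ae_eq_mul_expTransform`, applied with an extra
Bessel factor because the curve is differentiated in H⁻².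

By Plancherel Ŵ⁰ is in L², and in the plane the substitution s = |ξ|² has constant Jacobian, so F is
in L²(0,∞) (`integrableOn_sq_of_integrable_norm_sq`). But F is entire of exponential type and
bounded on Re z ≤ 0. Were it bounded on the positive half-line, Phragmén–Lindelöf in the two right
quadrants and Liouville would make it constant, and its decay at -∞ would make it 0. Square
integrability is reduced to this case by averaging F over unit intervals
(`expTransform_eq_zero_of_sq_integrable`). Hence F = 0 and W⁰ = 0. -/

/-- The two-sided Laplace transform (with positive sign) of a function on `(0, T)`. -/
noncomputable def expTransform (T : ℝ) (v : ℝ → ℂ) (z : ℂ) : ℂ :=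
  ∫ t in Ioo 0 T, Complex.exp (z * t) * v t

variable {T : ℝ} {v : ℝ → ℂ}

theorem norm_exp_mul_le {T t : ℝ} (ht : t ∈ Ioo 0 T) (z : ℂ) {M : ℝ} (hM : 0 ≤ M)
    (hz : z.re ≤ M) : ‖Complex.exp (z * t)‖ ≤ Real.exp (M * T) := by
  rw [Complex.norm_exp]
  have : (z * t).re = z.re * t := by simp
  rw [this, Real.exp_le_exp]
  nlinarith [ht.1, ht.2]

theorem integrableOn_exp_mul (hv : IntegrableOn v (Ioo 0 T)) (z : ℂ) :
    IntegrableOn (fun t : ℝ ↦ Complex.exp (z * t) * v t) (Ioo 0 T) := by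
  refine Integrable.bdd_mul (c := Real.exp (max z.re 0 * T)) hv (by fun_prop) ?_
  filter_upwards [ae_restrict_mem measurableSet_Ioo] with t ht
  exact norm_exp_mul_le ht z (le_max_right _ _) (le_max_left _ _)

theorem norm_expTransform_le (hv : IntegrableOn v (Ioo 0 T)) (z : ℂ) {M : ℝ} (hM : 0 ≤ M)
    (hz : z.re ≤ M) :
    ‖expTransform T v z‖ ≤ Real.exp (M * T) * ∫ t in Ioo 0 T, ‖v t‖ := by
  rw [expTransform, ← integral_const_mul]
  refine norm_integral_le_of_norm_le (hv.norm.const_mul _) ?_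
  filter_upwards [ae_restrict_mem measurableSet_Ioo] with t ht
  rw [norm_mul]
  gcongr
  exact norm_exp_mul_le ht z hM hz

theorem integrableOn_continuous_mul {g : ℝ → ℂ} (hg : Continuous g)
    (hv : IntegrableOn v (Ioo 0 T)) : IntegrableOn (fun t ↦ g t * v t) (Ioo 0 T) := by
  obtain ⟨C, hC⟩ := isCompact_Icc.exists_bound_of_continuousOn (s := Icc 0 T) hg.continuousOn
  refine Integrable.bdd_mul (c := C) hv (by fun_prop) ?_
  filter_upwards [ae_restrict_mem measurableSet_Ioo] with t ht
  exact hC t (Ioo_subset_Icc_self ht)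

theorem hasDerivAt_expTransform (hv : IntegrableOn v (Ioo 0 T)) (z : ℂ) :
    HasDerivAt (expTransform T v) (expTransform T (fun t : ℝ ↦ (t : ℂ) * v t) z) z := by
  have hv' : IntegrableOn (fun t : ℝ ↦ (t : ℂ) * v t) (Ioo 0 T) :=
    integrableOn_continuous_mul (by fun_prop) hv
  refine (hasDerivAt_integral_of_dominated_loc_of_deriv_le
    (F := fun z (t : ℝ) ↦ Complex.exp (z * t) * v t)
    (F' := fun z (t : ℝ) ↦ Complex.exp (z * t) * ((t : ℂ) * v t))
    (bound := fun t : ℝ ↦ Real.exp ((|z.re| + 1) * T) * ‖(t : ℂ) * v t‖)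
    (Metric.ball_mem_nhds z one_pos) ?_ (integrableOn_exp_mul hv z)
    (integrableOn_exp_mul hv' z).aestronglyMeasurable ?_ (hv'.norm.const_mul _) ?_).2
  · exact Eventually.of_forall fun w ↦ (integrableOn_exp_mul hv w).aestronglyMeasurable
  · filter_upwards [ae_restrict_mem measurableSet_Ioo] with t ht w hw
    rw [norm_mul]
    gcongr
    refine norm_exp_mul_le ht w (by positivity) ?_
    have h1 : |(w - z).re| ≤ ‖w - z‖ := Complex.abs_re_le_norm _
    rw [Metric.mem_ball, dist_eq_norm] at hw
    rw [Complex.sub_re] at h1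
    linarith [le_abs_self (w.re - z.re), le_abs_self z.re]
  · filter_upwards with t w _
    have := (((hasDerivAt_id w).mul_const (t : ℂ)).cexp).mul_const (v t)
    simpa [mul_assoc] using this

theorem tendsto_expTransform_sub_nat (hv : IntegrableOn v (Ioo 0 T)) (z : ℂ) :
    Tendsto (fun n : ℕ ↦ expTransform T v (z - n)) atTop (𝓝 0) := by
  rw [show (0 : ℂ) = ∫ t in Ioo 0 T, (0 : ℂ) by simp]
  refine tendsto_integral_of_dominated_convergence
    (fun t ↦ Real.exp (max z.re 0 * T) * ‖v t‖) ?_ (hv.norm.const_mul _) ?_ ?_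
  · exact fun n ↦ (integrableOn_exp_mul hv _).aestronglyMeasurable
  · intro n
    filter_upwards [ae_restrict_mem measurableSet_Ioo] with t ht
    rw [norm_mul]
    gcongr
    refine norm_exp_mul_le ht _ (le_max_right _ _) ?_
    simp only [Complex.sub_re, Complex.natCast_re]
    have : (0 : ℝ) ≤ n := n.cast_nonneg
    linarith [le_max_left z.re 0]
  · filter_upwards [ae_restrict_mem measurableSet_Ioo] with t ht
    have h1 : ∀ n : ℕ, Complex.exp ((z - n) * t) * v t
        = Complex.exp (z * t) * v t * (Complex.exp (-t)) ^ n := by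
      intro n
      rw [← Complex.exp_nat_mul, show (z - n) * (t : ℂ) = z * t + n * (-t) by ring,
        Complex.exp_add]
      ring
    simp_rw [h1]
    have h2 : Tendsto (fun n : ℕ ↦ (Complex.exp (-t)) ^ n) atTop (𝓝 0) := by
      apply tendsto_pow_atTop_nhds_zero_of_norm_lt_one
      rw [Complex.norm_exp]
      simpa using ht.1
    simpa using h2.const_mul (Complex.exp (z * t) * v t)

/-- Exponential type T gives growth order 1, below the critical order 2 for Phragmén–Lindelöf in a
quadrant. -/
theorem expTransform_isBigO (hv : IntegrableOn v (Ioo 0 T)) (l : Filter ℂ) :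
    ∃ c < (2 : ℝ), ∃ B, expTransform T v =O[l] fun z => Real.exp (B * ‖z‖ ^ c) := by
  refine ⟨1, by norm_num, T, Asymptotics.IsBigO.of_bound (∫ t in Ioo 0 T, ‖v t‖)
    (Eventually.of_forall fun z ↦ ?_)⟩
  rw [Real.rpow_one, Real.norm_eq_abs, Real.abs_exp, mul_comm, mul_comm T]
  exact norm_expTransform_le hv z (norm_nonneg z) (Complex.re_le_norm z)

/-- If the transform is bounded on the positive half-line, then it vanishes: it is bounded by the
Phragmén–Lindelöf principle, hence constant, and it tends to zero at `-∞`. -/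
theorem expTransform_eq_zero_of_bounded (hv : IntegrableOn v (Ioo 0 T)) {C : ℝ}
    (hC : ∀ x : ℝ, 0 ≤ x → ‖expTransform T v x‖ ≤ C) (z : ℂ) : expTransform T v z = 0 := by
  have hd : Differentiable ℂ (expTransform T v) :=
    fun z ↦ (hasDerivAt_expTransform hv z).differentiableAt
  set D := max C (∫ t in Ioo 0 T, ‖v t‖)
  have hleft : ∀ z : ℂ, z.re ≤ 0 → ‖expTransform T v z‖ ≤ D := fun z hz ↦ by
    have := norm_expTransform_le hv z le_rfl hz
    rw [zero_mul, Real.exp_zero, one_mul] at this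
    exact this.trans (le_max_right _ _)
  have hre : ∀ x : ℝ, 0 ≤ x → ‖expTransform T v x‖ ≤ D :=
    fun x hx ↦ (hC x hx).trans (le_max_left _ _)
  have him : ∀ x : ℝ, ‖expTransform T v (x * Complex.I)‖ ≤ D := fun x ↦ hleft _ (by simp)
  have hbdd : ∀ z, ‖expTransform T v z‖ ≤ D := by
    intro z
    rcases le_total z.re 0 with h | h
    · exact hleft z h
    rcases le_total z.im 0 with h' | h'
    · exact PhragmenLindelof.quadrant_IV hd.diffContOnCl (expTransform_isBigO hv _) hre
        (fun x _ ↦ him x) h h'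
    · exact PhragmenLindelof.quadrant_I hd.diffContOnCl (expTransform_isBigO hv _) hre
        (fun x _ ↦ him x) h h'
  have hb : Bornology.IsBounded (range (expTransform T v)) :=
    isBounded_iff_forall_norm_le.2 ⟨D, by rintro _ ⟨w, rfl⟩; exact hbdd w⟩
  have hconst : ∀ n : ℕ, expTransform T v (z - n) = expTransform T v z :=
    fun n ↦ hd.apply_eq_apply_of_bounded hb _ _
  have := tendsto_expTransform_sub_nat hv z
  simp_rw [hconst] at this
  exact tendsto_nhds_unique tendsto_const_nhds this

/-- The mean of `exp (t * θ)` over `θ ∈ (0, 1)`. -/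
noncomputable def expMean (t : ℝ) : ℂ := ∫ θ in (0 : ℝ)..1, Complex.exp (t * θ)

/-- Thus `expMean` is (eᵗ - 1)/t, extended continuously by 1 at t = 0. Multiplying v by eᵗ - 1 turns
its transform into a unit difference. -/
theorem mul_expMean (t : ℝ) : (t : ℂ) * expMean t = Complex.exp t - 1 := by
  rcases eq_or_ne t 0 with rfl | ht
  · simp
  · have ht' : (t : ℂ) ≠ 0 := by exact_mod_cast ht
    rw [expMean, integral_exp_mul_complex ht']
    field_simp
    simp

theorem continuous_expMean : Continuous expMean := by
  unfold expMean
  exact intervalIntegral.continuous_parametric_intervalIntegral_of_continuous' (by fun_prop) _ _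

theorem expTransform_expMean_mul (hv : IntegrableOn v (Ioo 0 T)) (x : ℝ) :
    expTransform T (fun t ↦ expMean t * v t) x = ∫ θ in x..x + 1, expTransform T v (θ : ℝ) := by
  have h1 : ∫ θ in x..x + 1, expTransform T v (θ : ℝ)
      = ∫ θ in (0 : ℝ)..1, expTransform T v ((x + θ : ℝ) : ℂ) := by
    rw [intervalIntegral.integral_comp_add_left (fun θ : ℝ ↦ expTransform T v (θ : ℂ)) x]
    simp
  rw [h1, intervalIntegral.integral_of_le zero_le_one]
  unfold expTransform
  rw [integral_integral_swap]
  · refine integral_congr_ae (Eventually.of_forall fun t ↦ ?_)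
    simp only [expMean]
    rw [← intervalIntegral.integral_of_le zero_le_one, ← mul_assoc,
      ← intervalIntegral.integral_const_mul, ← intervalIntegral.integral_mul_const]
    congr 1
    ext θ
    rw [← Complex.exp_add]
    push_cast
    ring_nf
  · have hg : Integrable (fun p : ℝ × ℝ ↦ v p.2)
        ((volume.restrict (Ioc (0 : ℝ) 1)).prod (volume.restrict (Ioo 0 T))) :=
      Integrable.comp_snd hv _
    refine Integrable.bdd_mul (c := Real.exp ((|x| + 1) * T)) hg
      (Continuous.aestronglyMeasurable (by fun_prop)) ?_
    rw [Measure.prod_restrict]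
    filter_upwards [ae_restrict_mem (measurableSet_Ioc.prod measurableSet_Ioo)] with p hp
    refine norm_exp_mul_le hp.2 _ (by positivity) ?_
    rw [Complex.ofReal_re]
    linarith [le_abs_self x, hp.1.2]

/-- If the transform is square integrable on the positive half-line, then it vanishes. -/
theorem expTransform_eq_zero_of_sq_integrable (hv : IntegrableOn v (Ioo 0 T))
    (h2 : IntegrableOn (fun x : ℝ ↦ ‖expTransform T v x‖ ^ 2) (Ioi 0)) (z : ℂ) :
    expTransform T v z = 0 := by
  have hd : Differentiable ℂ (expTransform T v) :=
    fun z ↦ (hasDerivAt_expTransform hv z).differentiableAt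
  have hcont : Continuous fun x : ℝ ↦ expTransform T v x :=
    hd.continuous.comp Complex.continuous_ofReal
  have hk := integrableOn_continuous_mul continuous_expMean hv
  -- The transform of `expMean * v` is the unit-interval average of F. The bound a ≤ 1 + a² turns
  -- square integrability of F into boundedness of this average on the half-line.
  have hmean : ∀ w, expTransform T (fun t ↦ expMean t * v t) w = 0 := by
    refine expTransform_eq_zero_of_bounded hk
      (C := 1 + ∫ x in Ioi (0 : ℝ), ‖expTransform T v x‖ ^ 2) fun x hx ↦ ?_
    rw [expTransform_expMean_mul hv]
    have hsub : Ioc x (x + 1) ⊆ Ioi 0 := fun y hy ↦ lt_of_le_of_lt hx hy.1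
    calc ‖∫ θ in x..x + 1, expTransform T v (θ : ℝ)‖
        ≤ ∫ θ in x..x + 1, (1 + ‖expTransform T v (θ : ℝ)‖ ^ 2) := by
          refine intervalIntegral.norm_integral_le_of_norm_le (by linarith) ?_
            (Continuous.intervalIntegrable (by fun_prop) _ _)
          filter_upwards with θ _
          nlinarith [sq_nonneg (‖expTransform T v (θ : ℝ)‖ - 1)]
      _ = 1 + ∫ θ in x..x + 1, ‖expTransform T v (θ : ℝ)‖ ^ 2 := by
          rw [intervalIntegral.integral_add (by simp)
            (Continuous.intervalIntegrable (by fun_prop) _ _)]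
          simp
      _ ≤ _ := by
          rw [intervalIntegral.integral_of_le (by linarith)]
          gcongr 1 + ?_
          exact setIntegral_mono_set h2 (Eventually.of_forall fun _ ↦ by positivity)
            hsub.eventuallyLE
  -- The derivative of the vanishing average is F(w + 1) - F(w), so F has period 1; its decay along
  -- z - n then forces F = 0.
  have hper : ∀ w, expTransform T v (w + 1) = expTransform T v w := by
    intro w
    have h0 : expTransform T (fun t : ℝ ↦ (t : ℂ) * (expMean t * v t)) w = 0 := by
      have := hasDerivAt_expTransform hk w
      rw [show expTransform T (fun t ↦ expMean t * v t) = fun _ ↦ 0 from funext hmean] at this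
      exact this.unique (hasDerivAt_const w 0)
    rw [← sub_eq_zero, ← h0]
    unfold expTransform
    rw [← integral_sub (integrableOn_exp_mul hv _) (integrableOn_exp_mul hv _)]
    congr 1
    ext t
    beta_reduce
    rw [← mul_assoc (t : ℂ), mul_expMean, add_mul, Complex.exp_add, one_mul]
    ring
  have hconst : ∀ n : ℕ, expTransform T v (z - n) = expTransform T v z := by
    intro n
    induction n with
    | zero => simp
    | succ n ih =>
      rw [← ih, ← hper]
      congr 1
      push_cast
      ring
  have := tendsto_expTransform_sub_nat hv z
  simp_rw [hconst] at this
  exact tendsto_nhds_unique tendsto_const_nhds this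

end ExpTransform

/-! ### Absolutely continuous curves in normed spaces. -/

section AbsolutelyContinuous

variable {E F G : Type*} [NormedAddCommGroup E] [NormedSpace ℝ E] [NormedAddCommGroup F]
  [NormedSpace ℝ F] [NormedAddCommGroup G] [NormedSpace ℝ G] {f : ℝ → E} {g : ℝ → F} {a b : ℝ}

open Filter AbsolutelyContinuousOnInterval in
theorem AbsolutelyContinuousOnInterval.of_dist_le {X Y Z : Type*} [PseudoMetricSpace X]
    [PseudoMetricSpace Y] [PseudoMetricSpace Z] {f : ℝ → X} {g : ℝ → Y} {h : ℝ → Z} {a b C D : ℝ}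
    (hf : AbsolutelyContinuousOnInterval f a b) (hg : AbsolutelyContinuousOnInterval g a b)
    (hh : ∀ s ∈ uIcc a b, ∀ t ∈ uIcc a b,
      dist (h s) (h t) ≤ C * dist (f s) (f t) + D * dist (g s) (g t)) :
    AbsolutelyContinuousOnInterval h a b := by
  unfold AbsolutelyContinuousOnInterval at hf hg ⊢
  refine squeeze_zero' ?_ ?_ (by simpa using (hf.const_mul C).add (hg.const_mul D))
  · exact Eventually.of_forall fun _ ↦ Finset.sum_nonneg fun i hi ↦ dist_nonneg
  rw [eventually_inf_principal]
  filter_upwards with I hI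
  simp only [Finset.mul_sum, ← Finset.sum_add_distrib]
  gcongr with i hi
  exact hh _ (hI.1 i hi).1 _ (hI.1 i hi).2

theorem AbsolutelyContinuousOnInterval.clm_apply (L : E →L[ℝ] F)
    (hf : AbsolutelyContinuousOnInterval f a b) :
    AbsolutelyContinuousOnInterval (fun t ↦ L (f t)) a b := by
  refine hf.of_dist_le (C := ‖L‖) (D := 0) hf fun s _ t _ ↦ ?_
  rw [zero_mul, add_zero, dist_eq_norm, dist_eq_norm, ← map_sub]
  exact L.le_opNorm _

theorem AbsolutelyContinuousOnInterval.bilin_apply (B : E →L[ℝ] F →L[ℝ] G)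
    (hf : AbsolutelyContinuousOnInterval f a b) (hg : AbsolutelyContinuousOnInterval g a b) :
    AbsolutelyContinuousOnInterval (fun t ↦ B (f t) (g t)) a b := by
  obtain ⟨C, hC⟩ := hf.exists_bound
  obtain ⟨D, hD⟩ := hg.exists_bound
  refine hf.of_dist_le (C := ‖B‖ * D) (D := ‖B‖ * C) hg fun s hs t ht ↦ ?_
  have h1 : B (f s) (g s) - B (f t) (g t) = B (f s - f t) (g s) + B (f t) (g s - g t) := by
    simp
  rw [dist_eq_norm, dist_eq_norm, dist_eq_norm, h1]
  refine (norm_add_le _ _).trans (add_le_add ?_ ?_)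
  · refine (B.le_opNorm₂ _ _).trans ?_
    rw [mul_right_comm]
    gcongr
    exact hD s hs
  · refine (B.le_opNorm₂ _ _).trans ?_
    gcongr
    exact hC t ht

/-- The fundamental theorem of calculus for complex-valued absolutely continuous functions. -/
theorem AbsolutelyContinuousOnInterval.integral_eq_sub_of_ae_hasDerivAt {h h' : ℝ → ℂ}
    (hab : a ≤ b) (hh : AbsolutelyContinuousOnInterval h a b)
    (hd : ∀ᵐ t ∂(volume.restrict (Ioo a b)), HasDerivAt h (h' t) t) :
    ∫ t in Ioo a b, h' t = h b - h a := by
  -- Real functionals reduce the claim to the real-valued theorem; real and imaginary parts also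
  -- supply the integrability of `h'`.
  have key : ∀ L : ℂ →L[ℝ] ℝ, IntegrableOn (fun t ↦ L (h' t)) (Ioo a b) ∧
      ∫ t in Ioo a b, L (h' t) = L (h b) - L (h a) := by
    intro L
    have hL := hh.clm_apply L
    have hae : (deriv fun t ↦ L (h t)) =ᵐ[volume.restrict (Ioo a b)] fun t ↦ L (h' t) := by
      filter_upwards [hd] with t ht
      exact (L.hasFDerivAt.comp_hasDerivAt t ht).deriv
    constructor
    · have := hL.intervalIntegrable_deriv
      rw [intervalIntegrable_iff_integrableOn_Ioo_of_le hab] at this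
      exact this.congr hae
    · rw [← integral_congr_ae hae, ← integral_Ioc_eq_integral_Ioo,
        ← intervalIntegral.integral_of_le hab]
      exact hL.integral_deriv_eq_sub
  have hint : IntegrableOn h' (Ioo a b) :=
    ⟨(((key Complex.reCLM).1.aestronglyMeasurable.aemeasurable.complex_ofReal.add
      ((key Complex.imCLM).1.aestronglyMeasurable.aemeasurable.complex_ofReal.mul_const
        Complex.I)).congr (Filter.Eventually.of_forall fun t ↦ by
          simp [Complex.re_add_im])).aestronglyMeasurable,
      ((key Complex.reCLM).1.norm.add (key Complex.imCLM).1.norm).2.mono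
        (Filter.Eventually.of_forall fun t ↦ by
          refine (Complex.norm_le_abs_re_add_abs_im _).trans ?_
          simpa using le_abs_self _)⟩
  apply Complex.ext
  · rw [Complex.sub_re]
    exact (Complex.reCLM.integral_comp_comm hint).symm.trans (key Complex.reCLM).2
  · rw [Complex.sub_im]
    exact (Complex.imCLM.integral_comp_comm hint).symm.trans (key Complex.imCLM).2

end AbsolutelyContinuous

/-! ### Solving the ODE on the Fourier side. -/

open scoped BoundedContinuousFunction

theorem BoundedContinuousFunction.exp_apply {X : Type*} [TopologicalSpace X] (f : X →ᵇ ℂ)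
    (x : X) : NormedSpace.exp f x = Complex.exp (f x) := by
  let _ : NormedAlgebra ℚ (X →ᵇ ℂ) := NormedAlgebra.restrictScalars ℚ ℝ _
  let ev : (X →ᵇ ℂ) →+* ℂ :=
    { toFun := fun f ↦ f x, map_one' := rfl, map_mul' := fun _ _ ↦ rfl, map_zero' := rfl,
      map_add' := fun _ _ ↦ rfl }
  rw [Complex.exp_eq_exp_ℂ]
  exact NormedSpace.map_exp ev (BoundedContinuousFunction.evalCLM ℝ x).continuous f

section Plane

instance isFiniteMeasure_restrict_closedBall (R : ℝ) :
    IsFiniteMeasure ((volume : Measure Plane).restrict (Metric.closedBall 0 R)) :=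
  ⟨by rw [Measure.restrict_apply_univ]; exact measure_closedBall_lt_top⟩

/-- The pairing `(m, f) ↦ ∫ m f` over the closed ball of radius `R`. -/
noncomputable def ballPairing (R : ℝ) :
    (Plane →ᵇ ℂ) →L[ℝ] Lp ℂ 2 (volume : Measure Plane) →L[ℝ] ℂ :=
  (ContinuousLinearMap.lpPairing (volume.restrict (Metric.closedBall (0 : Plane) R)) 2 2
    (ContinuousLinearMap.mul ℝ ℂ)).bilinearComp
    (BoundedContinuousFunction.toLp 2 _ ℝ)
    (LpToLpRestrictCLM Plane ℂ ℝ volume 2 (Metric.closedBall 0 R))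

theorem ballPairing_apply (R : ℝ) (m : Plane →ᵇ ℂ) (f : Lp ℂ 2 (volume : Measure Plane)) :
    ballPairing R m f = ∫ x in Metric.closedBall 0 R, m x * f x := by
  rw [ballPairing, ContinuousLinearMap.bilinearComp_apply,
    ContinuousLinearMap.lpPairing_eq_integral]
  refine integral_congr_ae ?_
  filter_upwards [BoundedContinuousFunction.coeFn_toLp 2
    ((volume : Measure Plane).restrict (Metric.closedBall 0 R)) ℝ m,
    LpToLpRestrictCLM_coeFn ℝ (Metric.closedBall (0 : Plane) R) f] with x h1 h2
  rw [ContinuousLinearMap.mul_apply', h1, h2]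

theorem integrableOn_bcf_mul_Lp (R : ℝ) (m : Plane →ᵇ ℂ) (f : Lp ℂ 2 (volume : Measure Plane)) :
    IntegrableOn (fun x ↦ m x * f x) (Metric.closedBall 0 R) := by
  have hf : IntegrableOn f (Metric.closedBall (0 : Plane) R) :=
    ((Lp.memLp f).locallyIntegrable (by norm_num)).integrableOn_isCompact
      (isCompact_closedBall 0 R)
  exact Integrable.bdd_mul (c := ‖m‖) hf m.continuous.aestronglyMeasurable
    (Filter.Eventually.of_forall m.norm_coe_le_norm)

/-- Variation of constants in weak form: the curve is tested against e^{tκ|ξ|²} g(ξ) with g of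
compact support. Differentiation in t cancels the unbounded term, and integration over (0, T) with
`y T = 0` leaves only the forcing. -/
theorem ae_eq_mul_expTransform {T κ : ℝ} (hT : 0 ≤ T) {c : ℝ → ℂ}
    (hc : IntegrableOn c (Ioo 0 T)) (β : Plane →ᵇ ℂ)
    {y z : ℝ → Lp ℂ 2 (volume : Measure Plane)} (hy : AbsolutelyContinuousOnInterval y 0 T)
    (hd : ∀ᵐ t ∂(volume.restrict (Ioo 0 T)), HasDerivAt y (z t) t)
    (hz : ∀ᵐ t ∂(volume.restrict (Ioo 0 T)),
      z t =ᵐ[volume] fun ξ ↦ -(κ * ‖ξ‖ ^ 2 : ℝ) * y t ξ - c t * β ξ)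
    (hyT : y T = 0) :
    y 0 =ᵐ[volume] fun ξ ↦ β ξ * expTransform T c (κ * ‖ξ‖ ^ 2 : ℝ) := by
  have hFc : Continuous (expTransform T c) :=
    Differentiable.continuous (𝕜 := ℂ) fun z ↦ (hasDerivAt_expTransform hc z).differentiableAt
  refine ae_eq_of_integral_contDiff_smul_eq
    ((Lp.memLp (y 0)).locallyIntegrable (by norm_num))
    (Continuous.locallyIntegrable (by fun_prop)) fun g hg hgc ↦ ?_
  obtain ⟨R, hR⟩ := hgc.isCompact.isBounded.subset_closedBall (0 : Plane)
  set S := Metric.closedBall (0 : Plane) R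
  have hS : ∀ f : Plane → ℂ, ∫ x, g x • f x = ∫ x in S, g x • f x := by
    refine fun f ↦ (setIntegral_eq_integral_of_forall_compl_eq_zero fun x hx ↦ ?_).symm
    rw [image_eq_zero_of_notMem_tsupport fun h ↦ hx (hR h), zero_smul]
  rw [hS, hS]
  obtain ⟨Cg, hCg⟩ := hgc.exists_bound_of_continuous hg.continuous
  let ψ : Plane →ᵇ ℂ := BoundedContinuousFunction.ofNormedAddCommGroup (fun ξ ↦ (g ξ : ℂ))
    (by have := hg.continuous; fun_prop) Cg (fun ξ ↦ by simpa using hCg ξ)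
  -- Truncating |ξ|² at R² changes nothing on the ball containing the support of g, and makes the
  -- multiplier an element of a Banach algebra, where t ↦ exp(ta) is differentiable in norm.
  let a : Plane →ᵇ ℂ := BoundedContinuousFunction.ofNormedAddCommGroup
    (fun ξ ↦ ((κ * min (‖ξ‖ ^ 2) (R ^ 2) : ℝ) : ℂ)) (by fun_prop) (|κ| * R ^ 2) (fun ξ ↦ by
      rw [Complex.norm_real, Real.norm_eq_abs, abs_mul,
        abs_of_nonneg (le_min (sq_nonneg _) (sq_nonneg R))]
      gcongr
      exact min_le_right _ _)
  have ha : ∀ ξ ∈ S, a ξ = (κ * ‖ξ‖ ^ 2 : ℝ) := fun ξ hξ ↦ by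
    have : ‖ξ‖ ^ 2 ≤ R ^ 2 := by
      gcongr
      simpa [S] using hξ
    simp [a, min_eq_left this]
  let e : ℝ → (Plane →ᵇ ℂ) := fun t ↦ NormedSpace.exp (t • a) * ψ
  have he : ∀ t ξ, e t ξ = Complex.exp (t * a ξ) * g ξ := fun t ξ ↦ by
    simp [e, BoundedContinuousFunction.exp_apply, ψ]
  have hed : ∀ t, HasDerivAt e (e t * a) t := fun t ↦ by
    have := (hasDerivAt_exp_smul_const a t).mul_const ψ
    rwa [mul_right_comm] at this
  have heAC : AbsolutelyContinuousOnInterval e 0 T := by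
    refine ContDiffOn.absolutelyContinuousOnInterval (ContDiff.contDiffOn ?_)
    rw [contDiff_one_iff_deriv]
    refine ⟨fun t ↦ (hed t).differentiableAt, ?_⟩
    rw [show deriv e = fun t ↦ e t * a from funext fun t ↦ (hed t).deriv]
    exact (continuous_iff_continuousAt.2 fun t ↦ (hed t).continuousAt).mul continuous_const
  have hFTC := (heAC.bilin_apply (ballPairing R) hy).integral_eq_sub_of_ae_hasDerivAt
    (h' := fun t ↦ ∫ ξ in S, -(e t ξ * (c t * β ξ))) hT (by
      filter_upwards [hd, hz] with t ht1 ht2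
      convert! ContinuousLinearMap.hasDerivAt_of_bilinear (B := ballPairing R) (fun _ ↦ hed t)
        (fun _ ↦ ht1) using 1
      rw [ballPairing_apply, ballPairing_apply, ← integral_add (integrableOn_bcf_mul_Lp _ _ _)
        (integrableOn_bcf_mul_Lp _ _ _)]
      refine setIntegral_congr_ae Metric.isClosed_closedBall.measurableSet ?_
      filter_upwards [ht2] with ξ h1 hξ
      have hmul : (e t * a) ξ = e t ξ * a ξ := rfl
      rw [h1, hmul, ha ξ hξ]
      ring)
  rw [hyT, map_zero, zero_sub, ballPairing_apply] at hFTC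
  have h0 : ∫ ξ in S, g ξ • y 0 ξ = ∫ ξ in S, e 0 ξ * y 0 ξ := by
    simp [he]
  rw [h0, ← neg_inj, ← hFTC, integral_integral_swap]
  · rw [← integral_neg]
    refine setIntegral_congr_fun Metric.isClosed_closedBall.measurableSet fun ξ hξ ↦ ?_
    simp only [expTransform, Complex.real_smul]
    rw [← mul_assoc, ← integral_const_mul, ← integral_neg]
    congr 1
    ext t
    rw [he, ha ξ hξ, mul_comm (t : ℂ)]
    ring
  · have hcont : Continuous fun p : ℝ × Plane ↦ -(e p.1 p.2 * β p.2) := by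
      have := hg.continuous
      simp_rw [he]
      fun_prop
    obtain ⟨C, hC⟩ := (isCompact_Icc.prod
      (isCompact_closedBall (0 : Plane) R)).exists_bound_of_continuousOn
      (s := Icc 0 T ×ˢ S) hcont.continuousOn
    have : IsFiniteMeasure ((volume : Measure Plane).restrict S) :=
      isFiniteMeasure_restrict_closedBall R
    have hfst : Integrable (fun p : ℝ × Plane ↦ c p.1)
        ((volume.restrict (Ioo 0 T)).prod (volume.restrict S)) := Integrable.comp_fst hc _
    refine (Integrable.bdd_mul (c := C) hfst hcont.aestronglyMeasurable ?_).congr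
      (Filter.Eventually.of_forall fun p ↦ by simp only [Function.uncurry]; ring)
    rw [Measure.prod_restrict]
    filter_upwards [ae_restrict_mem
      (measurableSet_Ioo.prod Metric.isClosed_closedBall.measurableSet)] with p hp
    exact hC p ⟨Ioo_subset_Icc_self hp.1, hp.2⟩

end Plane

/-! ### The Fourier transform of the controlled heat equation. -/

open FourierTransform
open scoped BoundedContinuousFunction Real ContDiff

theorem MeasureTheory.Lp.ae_eq_of_toTemperedDistribution_apply
    (z : Lp ℂ 2 (volume : Measure Plane)) {f : Plane → ℂ} (hf : LocallyIntegrable f)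
    (h : ∀ φ : 𝓢(Plane, ℂ), (z : 𝓢'(Plane, ℂ)) φ = ∫ x, φ x * f x) : z =ᵐ[volume] f := by
  refine ae_eq_of_integral_contDiff_smul_eq ((Lp.memLp z).locallyIntegrable (by norm_num)) hf
    fun g hg hgc ↦ ?_
  have hg₁ : HasCompactSupport (Complex.ofRealCLM ∘ g) := hgc.comp_left rfl
  have hg₂ : ContDiff ℝ ∞ (Complex.ofRealCLM ∘ g) := by fun_prop
  simpa using h (hg₁.toSchwartzMap hg₂)

/-- The symbol of the Bessel potential of order `-2`. -/
noncomputable def besselSymbol (ξ : Plane) : ℂ := ((1 + ‖ξ‖ ^ 2) ^ ((-2 : ℝ) / 2) : ℝ)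

theorem besselSymbol_ne_zero (ξ : Plane) : besselSymbol ξ ≠ 0 := by
  unfold besselSymbol
  rw [Complex.ofReal_ne_zero]
  positivity

theorem hasTemperateGrowth_besselSymbol : besselSymbol.HasTemperateGrowth := by
  unfold besselSymbol
  fun_prop

theorem norm_besselSymbol_le_one (ξ : Plane) : ‖besselSymbol ξ‖ ≤ 1 := by
  rw [besselSymbol, Complex.norm_real, Real.norm_eq_abs, abs_of_nonneg (by positivity)]
  exact Real.rpow_le_one_of_one_le_of_nonpos (by nlinarith [sq_nonneg ‖ξ‖]) (by norm_num)

theorem fourier_besselPotential_apply (f : 𝓢'(Plane, ℂ)) (φ : 𝓢(Plane, ℂ)) :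
    𝓕 (besselPotential Plane ℂ (-2) f) φ = 𝓕 f (SchwartzMap.smulLeftCLM ℂ besselSymbol φ) := by
  rw [fourier_besselPotential_eq_smulLeftCLM_fourier_apply]
  rfl

theorem fourier_laplacian_apply (f : 𝓢'(Plane, ℂ)) (φ : 𝓢(Plane, ℂ)) :
    𝓕 (Δ f) φ = -(2 * π : ℂ) ^ 2 *
      𝓕 f (SchwartzMap.smulLeftCLM ℂ (fun x : Plane ↦ Complex.ofReal (‖x‖ ^ 2)) φ) := by
  rw [laplacian_eq_fourierMultiplierCLM, fourierMultiplierCLM_apply]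
  rw [← Complex.coe_smul, FourierTransform.fourier_smul, fourier_fourierInv_eq]
  simp

theorem fourier_delta_zero_apply (φ : 𝓢(Plane, ℂ)) : 𝓕 (delta (0 : Plane)) φ = ∫ x, φ x := by
  rw [fourier_delta_zero]
  simp

theorem fourier_ae_eq_of_besselPotential_eq {w y : Lp ℂ 2 (volume : Measure Plane)}
    (h : besselPotential Plane ℂ (-2) (w : 𝓢'(Plane, ℂ)) = y) :
    (𝓕 y : Lp ℂ 2 (volume : Measure Plane)) =ᵐ[volume] fun ξ ↦
      besselSymbol ξ * (𝓕 w : Lp ℂ 2 (volume : Measure Plane)) ξ := by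
  have hc : Continuous besselSymbol := hasTemperateGrowth_besselSymbol.1.continuous
  refine Lp.ae_eq_of_toTemperedDistribution_apply _ ?_ fun φ ↦ ?_
  · exact LocallyIntegrable.continuous_mul hc ((Lp.memLp _).locallyIntegrable (by norm_num))
  · rw [← Lp.fourier_toTemperedDistribution_eq, ← h, fourier_besselPotential_apply,
      Lp.fourier_toTemperedDistribution_eq, Lp.toTemperedDistribution_apply]
    congr 1
    ext ξ
    rw [SchwartzMap.smulLeftCLM_apply_apply hasTemperateGrowth_besselSymbol]
    simp only [smul_eq_mul]
    ring

/-- Fourier multipliers commute, so the Laplacian term can be written through `y` itself; δ has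
transform 1, so its Bessel potential contributes just the symbol. -/
theorem fourier_ae_eq_of_besselPotential_heat {w y z : Lp ℂ 2 (volume : Measure Plane)} {c : ℂ}
    (hy : besselPotential Plane ℂ (-2) (w : 𝓢'(Plane, ℂ)) = y)
    (hz : besselPotential Plane ℂ (-2) (Δ (w : 𝓢'(Plane, ℂ)) - c • delta (0 : Plane)) = z) :
    (𝓕 z : Lp ℂ 2 (volume : Measure Plane)) =ᵐ[volume] fun ξ ↦
      -((2 * π) ^ 2 * ‖ξ‖ ^ 2 : ℝ) * (𝓕 y : Lp ℂ 2 (volume : Measure Plane)) ξ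
        - c * besselSymbol ξ := by
  have hc : Continuous besselSymbol := hasTemperateGrowth_besselSymbol.1.continuous
  have hli : ∀ f : Lp ℂ 2 (volume : Measure Plane), LocallyIntegrable f :=
    fun f ↦ (Lp.memLp f).locallyIntegrable (by norm_num)
  have hb2 : (fun x : Plane ↦ Complex.ofReal (‖x‖ ^ 2)).HasTemperateGrowth := by fun_prop
  refine Lp.ae_eq_of_toTemperedDistribution_apply _ ?_ fun φ ↦ ?_
  · exact (LocallyIntegrable.continuous_mul (by fun_prop) (hli _)).sub
      (Continuous.locallyIntegrable (by fun_prop))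
  · have h2 := SchwartzMap.integrable (μ := volume) (SchwartzMap.smulLeftCLM ℂ besselSymbol φ)
    have h1 : Integrable fun ξ ↦
        (SchwartzMap.smulLeftCLM ℂ (fun x : Plane ↦ Complex.ofReal (‖x‖ ^ 2)) φ) ξ *
        (𝓕 y : Lp ℂ 2 (volume : Measure Plane)) ξ :=
      MemLp.integrable_mul (SchwartzMap.memLp _ 2 volume) (Lp.memLp _)
    rw [← Lp.fourier_toTemperedDistribution_eq, ← hz, fourier_besselPotential_apply,
      sub_eq_add_neg, ← neg_smul, FourierTransform.fourier_add, FourierTransform.fourier_smul]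
    simp only [add_apply, smul_apply, fourier_laplacian_apply, fourier_delta_zero_apply,
      Lp.fourier_toTemperedDistribution_eq, Lp.toTemperedDistribution_apply]
    have h3 : ∫ ξ, (SchwartzMap.smulLeftCLM ℂ (fun x : Plane ↦ Complex.ofReal (‖x‖ ^ 2))
        (SchwartzMap.smulLeftCLM ℂ besselSymbol φ)) ξ •
          (𝓕 w : Lp ℂ 2 (volume : Measure Plane)) ξ =
        ∫ ξ, (SchwartzMap.smulLeftCLM ℂ (fun x : Plane ↦ Complex.ofReal (‖x‖ ^ 2)) φ) ξ *
          (𝓕 y : Lp ℂ 2 (volume : Measure Plane)) ξ := by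
      refine integral_congr_ae ?_
      filter_upwards [fourier_ae_eq_of_besselPotential_eq hy] with ξ hξ
      rw [hξ, SchwartzMap.smulLeftCLM_apply_apply hb2, SchwartzMap.smulLeftCLM_apply_apply hb2,
        SchwartzMap.smulLeftCLM_apply_apply hasTemperateGrowth_besselSymbol]
      simp only [smul_eq_mul]
      ring
    rw [h3, ← integral_const_mul, smul_eq_mul, ← integral_const_mul,
      ← integral_add (h1.const_mul _) (h2.const_mul _)]
    congr 1
    ext ξ
    rw [SchwartzMap.smulLeftCLM_apply_apply hb2,
      SchwartzMap.smulLeftCLM_apply_apply hasTemperateGrowth_besselSymbol]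
    simp only [smul_eq_mul]
    push_cast
    ring

/-- In polar coordinates the planar weight is r dr = ½ d(r²), so s = r² leaves the unweighted
measure ds. Dimension two is essential here. -/
theorem integrableOn_sq_of_integrable_norm_sq {f : ℝ → ℝ} {κ : ℝ} (hκ : 0 < κ)
    (h : Integrable (fun ξ : Plane ↦ f (κ * ‖ξ‖ ^ 2))) : IntegrableOn f (Ioi 0) := by
  have h1 := (integrable_fun_norm_addHaar (volume : Measure Plane)
    (f := fun r ↦ f (κ * r ^ 2))).1 h
  rw [finrank_euclideanSpace_fin] at h1
  have h2 : IntegrableOn (fun s ↦ f (κ * s)) (Ioi 0) := by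
    rw [← integrableOn_Ioi_comp_rpow_iff _ (two_ne_zero (α := ℝ))]
    refine IntegrableOn.congr_fun (h1.const_mul 2) (fun x _ ↦ ?_) measurableSet_Ioi
    norm_num
    ring
  rw [integrableOn_Ioi_comp_mul_left_iff _ _ hκ] at h2
  simpa using h2

/-! ### Conclusion. -/

theorem theorem3p14 (T : ℝ) (hT : 0 < T) (W0 : 𝓢'(Plane, ℂ)) (hW0 : W0 ∈ evenSobolev 0)
    (hcontr : IsControllable T W0 0) : W0 = 0 := by
  obtain ⟨-, u, hu, W, hW, -, hWT⟩ := hcontr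
  obtain ⟨V, ⟨Y, Z, hY, hYac, hYd⟩, hV⟩ := hW.equation
  have hmem : ∀ t ∈ Icc 0 T, ∃ w : Lp ℂ 2 (volume : Measure Plane), W t = w :=
    fun t ht ↦ memSobolev_zero_iff.1 (hW.mem t ht).1
  have h0 : (0 : ℝ) ∈ Icc 0 T := ⟨le_rfl, hT.le⟩
  let 𝓛 : Lp ℂ 2 (volume : Measure Plane) →L[ℝ] Lp ℂ 2 (volume : Measure Plane) :=
    (fourierCLM ℂ (Lp ℂ 2 (volume : Measure Plane))).restrictScalars ℝ
  let β : Plane →ᵇ ℂ := BoundedContinuousFunction.ofNormedAddCommGroup besselSymbol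
    hasTemperateGrowth_besselSymbol.1.continuous 1 norm_besselSymbol_le_one
  have hc : IntegrableOn (fun t ↦ 2 * u t) (Ioo 0 T) :=
    (hu.integrable le_top).const_mul 2
  have hYT : 𝓛 (Y T) = 0 := by
    have h1 := hY T ⟨hT.le, le_rfl⟩
    rw [hWT, map_zero] at h1
    have h2 : Y T = 0 := by
      have := LinearMap.ker_eq_bot'.1
        (Lp.ker_toTemperedDistributionCLM_eq_bot (F := ℂ) (μ := (volume : Measure Plane))
          (p := 2)) (Y T) h1.symm
      exact this
    rw [h2, map_zero]
  obtain ⟨w, hw⟩ := hmem 0 h0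
  have hY0 : besselPotential Plane ℂ (-2) (w : 𝓢'(Plane, ℂ)) = Y 0 := hw ▸ hY 0 h0
  have key := ae_eq_mul_expTransform (κ := (2 * π) ^ 2) hT.le hc β (hYac.clm_apply 𝓛)
    (z := fun t ↦ 𝓛 (Z t))
    (by
      filter_upwards [hYd] with t ht
      exact 𝓛.hasFDerivAt.comp_hasDerivAt t ht.2)
    (by
      filter_upwards [hYd, hV, ae_restrict_mem measurableSet_Ioo] with t h1 h2 ht
      obtain ⟨wt, hwt⟩ := hmem t (Ioo_subset_Icc_self ht)
      refine fourier_ae_eq_of_besselPotential_heat (w := wt) (hwt ▸ hY t (Ioo_subset_Icc_self ht)) ?_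
      rw [← hwt, ← h2.2, h1.1])
    hYT
  -- The Bessel symbol never vanishes, so it cancels from both sides; this recovers the transform of
  -- the initial state itself, which lies in L².
  have hw_eq : (𝓕 w : Lp ℂ 2 (volume : Measure Plane)) =ᵐ[volume]
      fun ξ ↦ expTransform T (fun t ↦ 2 * u t) ((2 * π) ^ 2 * ‖ξ‖ ^ 2 : ℝ) := by
    filter_upwards [key, fourier_ae_eq_of_besselPotential_eq hY0] with ξ h1 h2
    exact mul_left_cancel₀ (besselSymbol_ne_zero ξ) (h2.symm.trans h1)
  have hzero := expTransform_eq_zero_of_sq_integrable hc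
    (integrableOn_sq_of_integrable_norm_sq (κ := (2 * π) ^ 2) (by positivity)
      (f := fun x ↦ ‖expTransform T (fun t ↦ 2 * u t) x‖ ^ 2)
      (((memLp_two_iff_integrable_sq_norm (Lp.aestronglyMeasurable _)).1 (Lp.memLp (𝓕 w))).congr
        (by filter_upwards [hw_eq] with ξ h1; rw [h1])))
  have hFw : (𝓕 w : Lp ℂ 2 (volume : Measure Plane)) = 0 := by
    rw [Lp.eq_zero_iff_ae_eq_zero]
    filter_upwards [hw_eq] with ξ h1
    rw [h1, hzero]
    rfl
  have hw0 : w = 0 := by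
    rw [← norm_eq_zero, ← Lp.norm_fourier_eq, hFw, norm_zero]
  rw [← hW.initial, hw, hw0, ← Lp.toTemperedDistributionCLM_apply, map_zero]
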